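/- Let $V$ be a finite set and let $X=(X_v)_{v\in V}$ be a real random vector, where each $X_v$ takes values in a state space $\mathcal X_v\subseteq\mathbb R$ that is either a finite set or an open interval (possibly unbounded). Let $\mu=\bigotimes_{v\in V}\mu_v$, where $\mu_v$ is counting measure on $\mathcal X_v$ if $\mathcal X_v$ is finite and Lebesgue measure on $\mathcal X_v$ if $\mathcal X_v$ is an open interval. Suppose that the distribution of $X$ is ${\rm MTP}_2$, i.e. that it has a density $f$ with respect to $\mu$ such that $$f(x)f(y)\le f(x\wedge y)f(x\vee y)\qquad\text{for all }x,y\in\mathcal X=\prod_{v\in V}\mathcal X_v,$$ where $x\wedge y$ and $x\vee y$ are the coordinatewise minimum and maximum. Suppose also that no $X_v$ has a degenerate distribution (a point mass). Then there is a partition $\pi$ of $V$ into nonempty blocks such that the random vectors $X_B=(X_v)_{v\in B}$, $B\in\pi$, are mutually independent, and such that for every block $B\in\pi$ and all $u,v\in B$ the variables $X_u$ and $X_v$ are not (marginally) independent (for $u=v$ this says that $X_u$ is not independent of itself). -/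

import Mathlib

open MeasureTheory ProbabilityTheory
open scoped NNReal ENNReal

/-- An admissible state space of a coordinate: a finite set of reals (discrete coordinate) or an
open interval of the real line, possibly unbounded (continuous coordinate). -/
def IsStateSpace (S : Set ℝ) : Prop :=
  S.Finite ∨ (IsOpen S ∧ S.OrdConnected)

open Classical in
/-- The base measure of a coordinate with state space `S`: counting measure on `S` if `S` is
finite, Lebesgue measure on `S` otherwise. (A finite open interval is empty, and then both
restrictions are zero.) -/
noncomputable def coordBaseMeasure (S : Set ℝ) : Measure ℝ :=
  if S.Finite then Measure.count.restrict S else volume.restrict S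

/-- The standard base measure on the product of the state spaces, as a measure on `ℝ^V`. -/
noncomputable def standardBaseMeasure {V : Type*} [Fintype V] (S : V → Set ℝ) :
    Measure (V → ℝ) :=
  Measure.pi fun v => coordBaseMeasure (S v)

/-- `f` is multivariate totally positive of order two on the product of the `S v`; here `⊓`, `⊔`
are the coordinatewise minimum and maximum. -/
def IsMTP2Fun {V : Type*} (S : V → Set ℝ) (f : (V → ℝ) → ℝ≥0) : Prop :=
  ∀ x ∈ Set.univ.pi S, ∀ y ∈ Set.univ.pi S, f x * f y ≤ f (x ⊓ y) * f (x ⊔ y)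

/-- The distribution of the random vector `X`, with state spaces `S v`, is MTP₂: it has a
density with respect to the standard base measure that is an MTP₂ function. -/
def IsMTP2 {V Ω : Type*} [Fintype V] [MeasurableSpace Ω] (S : V → Set ℝ) (X : Ω → V → ℝ)
    (P : Measure Ω) : Prop :=
  ∃ f : (V → ℝ) → ℝ≥0, Measurable f ∧
    P.map X = (standardBaseMeasure S).withDensity (fun x => (f x : ℝ≥0∞)) ∧ IsMTP2Fun S f

/-! Marginal dependence turns out to be an equivalence relation, and its classes are the blocks. Of
MTP₂ only `IsLatticeAssociated` is used; it follows from the four functions theorem.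

Reflexivity is nondegeneracy. For transitivity (`mul_lt_inter_of_mul_lt_inter`), let `{X_u > a}` and
`{X_w > b}` each be strictly positively correlated with an upper half-line event of `X_v`. Cut the
range of `X_v` at the two thresholds. The covariance of the two events is the mean of their
conditional covariances, which are nonnegative, plus the covariance of their conditional
probabilities. The latter both increase along the strips and differ between the extreme strips, so
their covariance is positive.

Independence of the blocks rests on `inter_indep`: `cov(A ∩ B, E) + cov(A ∪ B, E) = cov(A, E) +
cov(B, E)` with all terms nonnegative for upper sets. Vanishing pairwise covariances thus pass to
intersections, hence to orthants, which generate. -/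

/-! ### The four functions theorem -/

lemma ENNReal.add_le_add_of_mul_le_mul {a b c d : ℝ≥0∞} (hac : a ≤ c) (hbc : b ≤ c)
    (h : a * b ≤ c * d) : a + b ≤ c + d := by
  rcases eq_or_ne c ∞ with rfl | hc
  · simp
  rcases eq_or_ne d ∞ with rfl | hd
  · simp
  lift c to ℝ≥0 using hc
  lift d to ℝ≥0 using hd
  lift a to ℝ≥0 using ne_top_of_le_ne_top ENNReal.coe_ne_top hac
  lift b to ℝ≥0 using ne_top_of_le_ne_top ENNReal.coe_ne_top hbc
  norm_cast at *
  rw [← NNReal.coe_le_coe] at *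
  push_cast at *
  have ha := a.coe_nonneg
  have hb := b.coe_nonneg
  rcases (c.coe_nonneg).eq_or_lt with h0 | h0
  · have := d.coe_nonneg
    linarith
  -- Expanding `(c - a)(c - b) ≥ 0` gives `c(a + b) ≤ c² + ab ≤ c(c + d)`; divide by `c`.
  · nlinarith [mul_nonneg (sub_nonneg.2 hac) (sub_nonneg.2 hbc)]

lemma ENNReal.le_of_add_self_le_add_self {a b : ℝ≥0∞} (h : a + a ≤ b + b) : a ≤ b := by
  rw [← two_mul, ← two_mul] at h
  exact (ENNReal.mul_le_mul_iff_right two_ne_zero ENNReal.ofNat_ne_top).1 h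

/-- The four functions theorem on a linear order. -/
lemma lintegral_mul_lintegral_le_of_forall_mul_le {α : Type*} [LinearOrder α] [MeasurableSpace α]
    (μ : Measure α) {f₁ f₂ f₃ f₄ : α → ℝ≥0∞} (h₁ : Measurable f₁) (h₂ : Measurable f₂)
    (h₃ : Measurable f₃) (h₄ : Measurable f₄)
    (h : ∀ x y, f₁ x * f₂ y ≤ f₃ (x ⊓ y) * f₄ (x ⊔ y)) :
    (∫⁻ x, f₁ x ∂μ) * ∫⁻ x, f₂ x ∂μ ≤ (∫⁻ x, f₃ x ∂μ) * ∫⁻ x, f₄ x ∂μ := by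
  -- Symmetrizing the double integral reduces the claim to a pointwise bound on unordered pairs.
  have key : ∀ {f g : α → ℝ≥0∞}, Measurable f → Measurable g →
      ((∫⁻ x, f x ∂μ) * ∫⁻ x, g x ∂μ) + (∫⁻ x, f x ∂μ) * ∫⁻ x, g x ∂μ =
        ∫⁻ x, ∫⁻ y, f x * g y + f y * g x ∂μ ∂μ := by
    intro f g hf hg
    have (x : α) : ∫⁻ y, f x * g y + f y * g x ∂μ =
        f x * ∫⁻ y, g y ∂μ + (∫⁻ y, f y ∂μ) * g x := by
      rw [lintegral_add_left (by fun_prop), lintegral_const_mul _ hg, lintegral_mul_const _ hf]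
    simp_rw [this]
    rw [lintegral_add_left (by fun_prop), lintegral_mul_const _ hf, lintegral_const_mul _ hg]
  apply ENNReal.le_of_add_self_le_add_self
  rw [key h₁ h₂, key h₃ h₄]
  refine lintegral_mono fun x => lintegral_mono fun y => ?_
  -- The term `f₃ x * f₄ y` dominates both summands on the left; the diagonal cases of `h` bound
  -- their product.
  have aux : ∀ x y : α, x ≤ y →
      f₁ x * f₂ y + f₁ y * f₂ x ≤ f₃ x * f₄ y + f₃ y * f₄ x := by
    intro x y hxy
    apply ENNReal.add_le_add_of_mul_le_mul
    · simpa [hxy] using h x y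
    · simpa [hxy] using h y x
    · have hx := h x x
      have hy := h y y
      rw [inf_idem, sup_idem] at hx hy
      calc f₁ x * f₂ y * (f₁ y * f₂ x) = (f₁ x * f₂ x) * (f₁ y * f₂ y) := by ring
        _ ≤ (f₃ x * f₄ x) * (f₃ y * f₄ y) := mul_le_mul' hx hy
        _ = _ := by ring
  rcases le_total x y with hxy | hxy
  · exact aux x y hxy
  · have := aux y x hxy
    rwa [add_comm (f₁ y * f₂ x), add_comm (f₃ y * f₄ x)] at this

lemma Function.update_inf_update {ι : Type*} [DecidableEq ι] {α : ι → Type*}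
    [∀ i, SemilatticeInf (α i)] (x y : ∀ i, α i) (i : ι) (a b : α i) :
    Function.update x i a ⊓ Function.update y i b = Function.update (x ⊓ y) i (a ⊓ b) := by
  ext j
  rcases eq_or_ne j i with rfl | hj <;> simp [*]

lemma Function.update_sup_update {ι : Type*} [DecidableEq ι] {α : ι → Type*}
    [∀ i, SemilatticeSup (α i)] (x y : ∀ i, α i) (i : ι) (a b : α i) :
    Function.update x i a ⊔ Function.update y i b = Function.update (x ⊔ y) i (a ⊔ b) := by
  ext j
  rcases eq_or_ne j i with rfl | hj <;> simp [*]

/-- The four functions theorem for marginal integrals over a product of linear orders. -/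
lemma lmarginal_mul_lmarginal_le_of_forall_mul_le {ι : Type*} [DecidableEq ι] {α : ι → Type*}
    [∀ i, LinearOrder (α i)] [∀ i, MeasurableSpace (α i)] (μ : ∀ i, Measure (α i))
    [∀ i, SigmaFinite (μ i)] {f₁ f₂ f₃ f₄ : (∀ i, α i) → ℝ≥0∞} (h₁ : Measurable f₁)
    (h₂ : Measurable f₂) (h₃ : Measurable f₃) (h₄ : Measurable f₄)
    (h : ∀ x y, f₁ x * f₂ y ≤ f₃ (x ⊓ y) * f₄ (x ⊔ y)) (s : Finset ι) (x y : ∀ i, α i) :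
    lmarginal μ s f₁ x * lmarginal μ s f₂ y ≤
      lmarginal μ s f₃ (x ⊓ y) * lmarginal μ s f₄ (x ⊔ y) := by
  induction s using Finset.induction_on generalizing x y with
  | empty => simpa using h x y
  | insert i s hi ih =>
    have hm {f : (∀ i, α i) → ℝ≥0∞} (hf : Measurable f) (z : ∀ i, α i) :
        Measurable fun a => lmarginal μ s f (Function.update z i a) :=
      (hf.lmarginal μ).comp (measurable_update z)
    simp_rw [lmarginal_insert _ h₁ hi, lmarginal_insert _ h₂ hi, lmarginal_insert _ h₃ hi,
      lmarginal_insert _ h₄ hi]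
    have := fun a b => ih (Function.update x i a) (Function.update y i b)
    simp_rw [Function.update_inf_update, Function.update_sup_update] at this
    exact lintegral_mul_lintegral_le_of_forall_mul_le (μ i) (hm h₁ x) (hm h₂ y) (hm h₃ (x ⊓ y))
      (hm h₄ (x ⊔ y)) this

/-- The four functions theorem for a product measure on a product of linear orders. -/
lemma lintegral_pi_mul_lintegral_pi_le_of_forall_mul_le {ι : Type*} [Fintype ι] {α : ι → Type*}
    [∀ i, LinearOrder (α i)] [∀ i, MeasurableSpace (α i)] (μ : ∀ i, Measure (α i))
    [∀ i, SigmaFinite (μ i)] {f₁ f₂ f₃ f₄ : (∀ i, α i) → ℝ≥0∞} (h₁ : Measurable f₁)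
    (h₂ : Measurable f₂) (h₃ : Measurable f₃) (h₄ : Measurable f₄)
    (h : ∀ x y, f₁ x * f₂ y ≤ f₃ (x ⊓ y) * f₄ (x ⊔ y)) :
    (∫⁻ x, f₁ x ∂Measure.pi μ) * ∫⁻ x, f₂ x ∂Measure.pi μ ≤
      (∫⁻ x, f₃ x ∂Measure.pi μ) * ∫⁻ x, f₄ x ∂Measure.pi μ := by
  classical
  rcases isEmpty_or_nonempty (∀ i, α i) with hα | ⟨⟨x⟩⟩
  · simp
  · have := lmarginal_mul_lmarginal_le_of_forall_mul_le μ h₁ h₂ h₃ h₄ h Finset.univ x x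
    simpa using this

/-! ### Lattice association of MTP₂ distributions -/

/-- A measure on `ℝ^V` is lattice associated if, conditionally on any measurable sublattice,
any two measurable upper sets are nonnegatively correlated. -/
def IsLatticeAssociated {V : Type*} (ν : Measure (V → ℝ)) : Prop :=
  ∀ ⦃L A B : Set (V → ℝ)⦄, MeasurableSet L → MeasurableSet A → MeasurableSet B →
    SupClosed L → InfClosed L → IsUpperSet A → IsUpperSet B →
    ν.real (A ∩ L) * ν.real (B ∩ L) ≤ ν.real L * ν.real (A ∩ B ∩ L)

/-- Four functions theorem for `g` cut off to `A ∩ L`, `B ∩ L`, `L` and `A ∩ B ∩ L`. -/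
lemma isLatticeAssociated_withDensity {V : Type*} [Fintype V] (μ : V → Measure ℝ)
    [∀ v, SigmaFinite (μ v)] {g : (V → ℝ) → ℝ≥0∞} (hg : Measurable g)
    (hmtp : ∀ x y, g x * g y ≤ g (x ⊓ y) * g (x ⊔ y))
    [IsFiniteMeasure ((Measure.pi μ).withDensity g)] :
    IsLatticeAssociated ((Measure.pi μ).withDensity g) := by
  intro L A B hL hA hB hsup hinf hAu hBu
  simp only [measureReal_def, ← ENNReal.toReal_mul]
  refine ENNReal.toReal_mono (by finiteness) ?_
  rw [withDensity_apply _ (hA.inter hL), withDensity_apply _ (hB.inter hL),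
    withDensity_apply _ hL, withDensity_apply _ ((hA.inter hB).inter hL),
    ← lintegral_indicator (hA.inter hL), ← lintegral_indicator (hB.inter hL),
    ← lintegral_indicator hL, ← lintegral_indicator ((hA.inter hB).inter hL)]
  refine lintegral_pi_mul_lintegral_pi_le_of_forall_mul_le μ (hg.indicator (hA.inter hL))
    (hg.indicator (hB.inter hL)) (hg.indicator hL) (hg.indicator ((hA.inter hB).inter hL)) ?_
  intro x y
  by_cases hx : x ∈ A ∩ L
  · by_cases hy : y ∈ B ∩ L
    · have h1 : x ⊓ y ∈ L := hinf hx.2 hy.2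
      have h2 : x ⊔ y ∈ A ∩ B ∩ L :=
        ⟨⟨hAu le_sup_left hx.1, hBu le_sup_right hy.1⟩, hsup hx.2 hy.2⟩
      simpa only [Set.indicator_of_mem hx, Set.indicator_of_mem hy, Set.indicator_of_mem h1,
        Set.indicator_of_mem h2] using hmtp x y
    · simp [Set.indicator_of_notMem hy]
  · simp [Set.indicator_of_notMem hx]

lemma IsStateSpace.measurableSet {S : Set ℝ} (hS : IsStateSpace S) : MeasurableSet S :=
  hS.elim Set.Finite.measurableSet fun h => h.1.measurableSet

instance sigmaFinite_coordBaseMeasure (S : Set ℝ) : SigmaFinite (coordBaseMeasure S) := by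
  unfold coordBaseMeasure
  split_ifs with h
  · have : IsFiniteMeasure ((Measure.count : Measure ℝ).restrict S) :=
      ⟨by simpa using Measure.count_apply_lt_top.2 h⟩
    infer_instance
  · infer_instance

lemma IsStateSpace.ae_mem_coordBaseMeasure {S : Set ℝ} (hS : IsStateSpace S) :
    ∀ᵐ x ∂coordBaseMeasure S, x ∈ S := by
  unfold coordBaseMeasure
  split_ifs
  all_goals exact ae_restrict_mem hS.measurableSet

lemma IsMTP2.isLatticeAssociated {V Ω : Type*} [Fintype V] [MeasurableSpace Ω] {P : Measure Ω}
    [IsFiniteMeasure P] {S : V → Set ℝ} (hS : ∀ v, IsStateSpace (S v)) {X : Ω → V → ℝ}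
    (h : IsMTP2 S X P) : IsLatticeAssociated (P.map X) := by
  obtain ⟨f, hf, hmap, hmtp⟩ := h
  set T : Set (V → ℝ) := Set.univ.pi S
  have hT : MeasurableSet T := MeasurableSet.univ_pi fun v => (hS v).measurableSet
  -- The MTP₂ inequality is known only on `T`. As `T` is a sublattice, cutting `f` off outside it
  -- makes the inequality global.
  have hae : (fun x => (f x : ℝ≥0∞)) =ᵐ[standardBaseMeasure S]
      T.indicator fun x => (f x : ℝ≥0∞) := by
    have : ∀ᵐ x ∂standardBaseMeasure S, ∀ v, x v ∈ S v :=
      Filter.eventually_all.2 fun v =>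
        (Measure.tendsto_eval_ae_ae (μ := fun v => coordBaseMeasure (S v)) (i := v)).eventually
          (hS v).ae_mem_coordBaseMeasure
    filter_upwards [this] with x hx
    rw [Set.indicator_of_mem (show x ∈ T from fun v _ => hx v)]
  rw [withDensity_congr_ae hae] at hmap
  have hfin : IsFiniteMeasure ((standardBaseMeasure S).withDensity
      (T.indicator fun x => (f x : ℝ≥0∞))) := hmap ▸ inferInstance
  rw [hmap]
  unfold standardBaseMeasure at hfin ⊢
  refine isLatticeAssociated_withDensity _ (hf.coe_nnreal_ennreal.indicator hT) fun x y => ?_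
  by_cases hx : x ∈ T
  · by_cases hy : y ∈ T
    · have h1 : x ⊓ y ∈ T := fun v _ => by
        rcases min_choice (x v) (y v) with h | h
        · simpa [h] using hx v trivial
        · simpa [h] using hy v trivial
      have h2 : x ⊔ y ∈ T := fun v _ => by
        rcases max_choice (x v) (y v) with h | h
        · simpa [h] using hx v trivial
        · simpa [h] using hy v trivial
      simp only [Set.indicator_of_mem, hx, hy, h1, h2]
      exact_mod_cast hmtp x hx y hy
    · simp [Set.indicator_of_notMem hy]
  · simp [Set.indicator_of_notMem hx]

/-! ### Strict correlation through a coordinate -/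

namespace IsLatticeAssociated

variable {V : Type*} {ν : Measure (V → ℝ)}

lemma mul_le_inter [IsProbabilityMeasure ν] (hν : IsLatticeAssociated ν) {A B : Set (V → ℝ)}
    (hA : MeasurableSet A) (hB : MeasurableSet B) (hAu : IsUpperSet A) (hBu : IsUpperSet B) :
    ν.real A * ν.real B ≤ ν.real (A ∩ B) := by
  simpa using hν MeasurableSet.univ hA hB supClosed_univ infClosed_univ hAu hBu

/-- Conditionally on the coordinate `v`, probabilities of upper sets are monotone. -/
lemma mul_le_mul_of_separated [IsFiniteMeasure ν] (hν : IsLatticeAssociated ν)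
    {U : Set (V → ℝ)} (hU : MeasurableSet U) (hUu : IsUpperSet U) (v : V) {I J : Set ℝ}
    (hI : MeasurableSet I) (hJ : MeasurableSet J) {r : ℝ} (hIr : I ⊆ Set.Iic r)
    (hJr : J ⊆ Set.Ioi r) :
    ν.real (U ∩ {x | x v ∈ I}) * ν.real {x | x v ∈ J} ≤
      ν.real (U ∩ {x | x v ∈ J}) * ν.real {x | x v ∈ I} := by
  have hm {K : Set ℝ} (hK : MeasurableSet K) : MeasurableSet {x : V → ℝ | x v ∈ K} :=
    measurable_pi_apply v hK
  have hd : Disjoint {x : V → ℝ | x v ∈ I} {x | x v ∈ J} :=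
    Set.disjoint_left.2 fun x hx hy => not_lt.2 (show x v ≤ r from hIr hx) (hJr hy)
  -- A condition on one coordinate defines a sublattice, since `ℝ` is a chain. In `L` the half-space
  -- `x v > r` cuts out exactly the `J` part.
  have h := hν (L := {x | x v ∈ I} ∪ {x | x v ∈ J}) (A := U) (B := {x | x v ∈ Set.Ioi r})
    ((hm hI).union (hm hJ)) hU (hm measurableSet_Ioi)
    (fun x hx y hy => by
      change x v ∈ I ∪ J at hx
      change y v ∈ I ∪ J at hy
      change x v ⊔ y v ∈ I ∪ J
      rcases max_choice (x v) (y v) with h | h <;> rwa [h])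
    (fun x hx y hy => by
      change x v ∈ I ∪ J at hx
      change y v ∈ I ∪ J at hy
      change x v ⊓ y v ∈ I ∪ J
      rcases min_choice (x v) (y v) with h | h <;> rwa [h])
    hUu (fun x y hxy hx => lt_of_lt_of_le hx (hxy v))
  have e : {x : V → ℝ | x v ∈ Set.Ioi r} ∩ ({x | x v ∈ I} ∪ {x | x v ∈ J}) = {x | x v ∈ J} := by
    ext x
    constructor
    · rintro ⟨h1, h2 | h2⟩
      · exact absurd (show x v ≤ r from hIr h2) (not_le.2 h1)
      · exact h2
    · exact fun h => ⟨hJr h, Or.inr h⟩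
  rw [Set.inter_assoc, e, Set.inter_union_distrib_left, measureReal_union hd (hm hJ),
    measureReal_union (hd.mono Set.inter_subset_right Set.inter_subset_right)
      (hU.inter (hm hJ))] at h
  linarith

end IsLatticeAssociated

/-- The total covariance formula over three strips of mass `pᵢ`, where `uᵢ`, `wᵢ`, `zᵢ` are the
masses of `U`, `W`, `U ∩ W` in them. Hypotheses are products, not quotients, because strips may be
null. -/
lemma sum_mul_sum_lt_of_stochastically_monotone {p₁ p₂ p₃ u₁ u₂ u₃ w₁ w₂ w₃ z₁ z₂ z₃ : ℝ}
    (hp₁ : 0 ≤ p₁) (hp₂ : 0 ≤ p₂) (hp₃ : 0 ≤ p₃) (hp : p₁ + p₂ + p₃ = 1)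
    (hu₁ : 0 ≤ u₁) (hu₂ : 0 ≤ u₂) (hu₃ : 0 ≤ u₃) (hw₁ : 0 ≤ w₁) (hw₂ : 0 ≤ w₂) (hw₃ : 0 ≤ w₃)
    (hup₁ : u₁ ≤ p₁) (hup₂ : u₂ ≤ p₂) (hup₃ : u₃ ≤ p₃)
    (hwp₁ : w₁ ≤ p₁) (hwp₂ : w₂ ≤ p₂) (hwp₃ : w₃ ≤ p₃)
    (hz₁ : 0 ≤ z₁) (hz₂ : 0 ≤ z₂) (hz₃ : 0 ≤ z₃)
    (hzu₁ : u₁ * w₁ ≤ p₁ * z₁) (hzu₂ : u₂ * w₂ ≤ p₂ * z₂) (hzu₃ : u₃ * w₃ ≤ p₃ * z₃)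
    (hu₁₂ : u₁ * p₂ ≤ u₂ * p₁) (hu₁₃ : u₁ * p₃ ≤ u₃ * p₁) (hu₂₃ : u₂ * p₃ ≤ u₃ * p₂)
    (hw₁₂ : w₁ * p₂ ≤ w₂ * p₁) (hw₁₃ : w₁ * p₃ ≤ w₃ * p₁) (hw₂₃ : w₂ * p₃ ≤ w₃ * p₂)
    (hu : (u₁ + u₂ + u₃) * (p₂ + p₃) < u₂ + u₃) (hw : (w₁ + w₂ + w₃) * p₃ < w₃) :
    (u₁ + u₂ + u₃) * (w₁ + w₂ + w₃) < z₁ + z₂ + z₃ := by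
  have repr {p u : ℝ} (h0 : 0 ≤ u) (h : u ≤ p) : ∃ F, u = p * F := by
    rcases (h0.trans h).eq_or_lt with h' | h'
    · exact ⟨0, by linarith⟩
    · exact ⟨u / p, by field_simp⟩
  obtain ⟨F₁, rfl⟩ := repr hu₁ hup₁
  obtain ⟨F₂, rfl⟩ := repr hu₂ hup₂
  obtain ⟨F₃, rfl⟩ := repr hu₃ hup₃
  obtain ⟨G₁, rfl⟩ := repr hw₁ hwp₁
  obtain ⟨G₂, rfl⟩ := repr hw₂ hwp₂
  obtain ⟨G₃, rfl⟩ := repr hw₃ hwp₃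
  have hz {p F G z : ℝ} (hp : 0 ≤ p) (hz : 0 ≤ z) (h : p * F * (p * G) ≤ p * z) :
      p * F * G ≤ z := by
    rcases hp.eq_or_lt with rfl | h'
    · simpa using hz
    · refine le_of_mul_le_mul_left ?_ h'
      linarith
  have hc {p q F F' G G' : ℝ} (hp : 0 ≤ p) (hq : 0 ≤ q) (h : p * F * q ≤ q * F' * p)
      (h' : p * G * q ≤ q * G' * p) : 0 ≤ p * q * ((F' - F) * (G' - G)) := by
    rcases (mul_nonneg hp hq).eq_or_lt with h0 | h0
    · simp [← h0]
    · refine mul_nonneg h0.le (mul_nonneg ?_ ?_)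
      · refine nonneg_of_mul_nonneg_right (b := F' - F) ?_ h0
        linarith
      · refine nonneg_of_mul_nonneg_right (b := G' - G) ?_ h0
        linarith
  have z1 := hz hp₁ hz₁ hzu₁
  have z2 := hz hp₂ hz₂ hzu₂
  have z3 := hz hp₃ hz₃ hzu₃
  have c12 := hc hp₁ hp₂ hu₁₂ hw₁₂
  have c23 := hc hp₂ hp₃ hu₂₃ hw₂₃
  obtain rfl : p₁ = 1 - p₂ - p₃ := by linarith
  set p₁ := 1 - p₂ - p₃ with hp1
  -- These are the covariances in `hu` and `hw`, expanded using `p₁ + p₂ + p₃ = 1`.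
  have hF : 0 < p₁ * (p₂ * (F₂ - F₁) + p₃ * (F₃ - F₁)) := by rw [hp1] at *; linarith
  have hG : 0 < p₃ * (p₁ * (G₃ - G₁) + p₂ * (G₃ - G₂)) := by rw [hp1] at *; linarith
  have p1 : 0 < p₁ := hp₁.lt_of_ne fun h => by simp [← h] at hF
  have p3 : 0 < p₃ := hp₃.lt_of_ne fun h => by simp [← h] at hG
  have hF' : 0 < p₂ * (F₂ - F₁) + p₃ * (F₃ - F₁) := pos_of_mul_pos_right hF p1.le
  have hG' : 0 < p₁ * (G₃ - G₁) + p₂ * (G₃ - G₂) := pos_of_mul_pos_right hG p3.le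
  -- If this failed, the middle strip would have positive mass, and monotonicity through it would
  -- give `F₁ < F₂ ≤ F₃`.
  have hF13 : 0 < F₃ - F₁ := by
    by_contra! h
    have h2 : 0 < p₂ * (F₂ - F₁) := by nlinarith
    have p2 : 0 < p₂ := hp₂.lt_of_ne fun h => by simp [← h] at h2
    have h3 : 0 < F₂ - F₁ := pos_of_mul_pos_right h2 hp₂
    have h4 : 0 ≤ F₃ - F₂ :=
      nonneg_of_mul_nonneg_right (b := F₃ - F₂) (by linarith) (mul_pos p2 p3)
    linarith
  have hG13 : 0 < G₃ - G₁ := by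
    by_contra! h
    have h2 : 0 < p₂ * (G₃ - G₂) := by nlinarith
    have p2 : 0 < p₂ := hp₂.lt_of_ne fun h => by simp [← h] at h2
    have h3 : 0 < G₃ - G₂ := pos_of_mul_pos_right h2 hp₂
    have h4 : 0 ≤ G₂ - G₁ :=
      nonneg_of_mul_nonneg_right (b := G₂ - G₁) (by linarith) (mul_pos p1 p2)
    linarith
  have c13 : 0 < p₁ * p₃ * ((F₃ - F₁) * (G₃ - G₁)) :=
    mul_pos (mul_pos p1 p3) (mul_pos hF13 hG13)
  have key : (p₁ + p₂ + p₃) * (p₁ * F₁ * G₁ + p₂ * F₂ * G₂ + p₃ * F₃ * G₃) -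
      (p₁ * F₁ + p₂ * F₂ + p₃ * F₃) * (p₁ * G₁ + p₂ * G₂ + p₃ * G₃) =
      p₁ * p₂ * ((F₂ - F₁) * (G₂ - G₁)) + p₁ * p₃ * ((F₃ - F₁) * (G₃ - G₁)) +
        p₂ * p₃ * ((F₃ - F₂) * (G₃ - G₂)) := by ring
  rw [hp, one_mul] at key
  linarith

namespace IsLatticeAssociated

variable {V : Type*} {ν : Measure (V → ℝ)}

lemma mul_lt_inter_of_mul_lt_inter [IsProbabilityMeasure ν] (hν : IsLatticeAssociated ν)
    {U W : Set (V → ℝ)} (hU : MeasurableSet U) (hW : MeasurableSet W) (hUu : IsUpperSet U)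
    (hWu : IsUpperSet W) (v : V) {s t : ℝ} (hst : s ≤ t)
    (hUs : ν.real U * ν.real {x | s < x v} < ν.real (U ∩ {x | s < x v}))
    (hWt : ν.real W * ν.real {x | t < x v} < ν.real (W ∩ {x | t < x v})) :
    ν.real U * ν.real W < ν.real (U ∩ W) := by
  set C₁ : Set (V → ℝ) := {x | x v ∈ Set.Iic s}
  set C₂ : Set (V → ℝ) := {x | x v ∈ Set.Ioc s t}
  set C₃ : Set (V → ℝ) := {x | x v ∈ Set.Ioi t}
  have m {K : Set ℝ} (hK : MeasurableSet K) : MeasurableSet {x : V → ℝ | x v ∈ K} :=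
    measurable_pi_apply v hK
  have m₁ : MeasurableSet C₁ := m measurableSet_Iic
  have m₂ : MeasurableSet C₂ := m measurableSet_Ioc
  have m₃ : MeasurableSet C₃ := m measurableSet_Ioi
  have sup {K : Set ℝ} : SupClosed {x : V → ℝ | x v ∈ K} := fun x hx y hy => by
    change x v ⊔ y v ∈ K
    rcases max_choice (x v) (y v) with h | h
    · rw [h]; exact hx
    · rw [h]; exact hy
  have inf {K : Set ℝ} : InfClosed {x : V → ℝ | x v ∈ K} := fun x hx y hy => by
    change x v ⊓ y v ∈ K
    rcases min_choice (x v) (y v) with h | h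
    · rw [h]; exact hx
    · rw [h]; exact hy
  have e₂₃ : {x : V → ℝ | s < x v} = C₂ ∪ C₃ := by
    ext x
    change x v ∈ Set.Ioi s ↔ x v ∈ Set.Ioc s t ∪ Set.Ioi t
    rw [Set.Ioc_union_Ioi_eq_Ioi hst]
  have d₂₃ : Disjoint C₂ C₃ := Set.disjoint_left.2 fun x hx hy => not_lt.2 hx.2 hy
  have eU {A : Set (V → ℝ)} (hA : MeasurableSet A) :
      ν.real (A ∩ {x | s < x v}) = ν.real (A ∩ C₂) + ν.real (A ∩ C₃) := by
    rw [e₂₃, Set.inter_union_distrib_left, measureReal_union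
      (d₂₃.mono Set.inter_subset_right Set.inter_subset_right) (hA.inter m₃)]
  have eA {A : Set (V → ℝ)} (hA : MeasurableSet A) :
      ν.real A = ν.real (A ∩ C₁) + ν.real (A ∩ C₂) + ν.real (A ∩ C₃) := by
    rw [add_assoc, ← eU hA, ← measureReal_inter_add_sdiff m₁]
    congr 2
    ext x
    simp [C₁]
  have e1 := eA MeasurableSet.univ
  have e2 := eU MeasurableSet.univ
  simp only [Set.univ_inter, probReal_univ] at e1 e2
  rw [e2, eU hU, eA hU] at hUs
  change ν.real W * ν.real C₃ < ν.real (W ∩ C₃) at hWt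
  rw [eA hW] at hWt
  rw [eA hU, eA hW, eA (hU.inter hW)]
  have le {A : Set (V → ℝ)} (C : Set (V → ℝ)) : ν.real (A ∩ C) ≤ ν.real C :=
    measureReal_mono Set.inter_subset_right
  have s₂ : Set.Ioc s t ⊆ Set.Ioi s := Set.Ioc_subset_Ioi_self
  have s₂' : Set.Ioc s t ⊆ Set.Iic t := Set.Ioc_subset_Iic_self
  have s₃ : Set.Ioi t ⊆ Set.Ioi s := Set.Ioi_subset_Ioi hst
  refine sum_mul_sum_lt_of_stochastically_monotone (p₁ := ν.real C₁) (p₂ := ν.real C₂)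
    (p₃ := ν.real C₃) measureReal_nonneg measureReal_nonneg measureReal_nonneg
    e1.symm measureReal_nonneg measureReal_nonneg measureReal_nonneg measureReal_nonneg
    measureReal_nonneg measureReal_nonneg (le _) (le _) (le _) (le _) (le _) (le _)
    measureReal_nonneg measureReal_nonneg measureReal_nonneg
    (hν m₁ hU hW sup inf hUu hWu) (hν m₂ hU hW sup inf hUu hWu) (hν m₃ hU hW sup inf hUu hWu)
    ?_ ?_ ?_ ?_ ?_ ?_ hUs hWt
  · exact hν.mul_le_mul_of_separated hU hUu v measurableSet_Iic measurableSet_Ioc subset_rfl s₂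
  · exact hν.mul_le_mul_of_separated hU hUu v measurableSet_Iic measurableSet_Ioi subset_rfl s₃
  · exact hν.mul_le_mul_of_separated hU hUu v measurableSet_Ioc measurableSet_Ioi s₂' subset_rfl
  · exact hν.mul_le_mul_of_separated hW hWu v measurableSet_Iic measurableSet_Ioc subset_rfl s₂
  · exact hν.mul_le_mul_of_separated hW hWu v measurableSet_Iic measurableSet_Ioi subset_rfl s₃
  · exact hν.mul_le_mul_of_separated hW hWu v measurableSet_Ioc measurableSet_Ioi s₂' subset_rfl

/-! ### From pairwise to mutual independence of upper sets -/

/-- The upper sets that are independent of a given upper set are closed under intersection. -/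
lemma inter_indep [IsProbabilityMeasure ν] (hν : IsLatticeAssociated ν) {A B E : Set (V → ℝ)}
    (hA : MeasurableSet A) (hB : MeasurableSet B) (hE : MeasurableSet E) (hAu : IsUpperSet A)
    (hBu : IsUpperSet B) (hEu : IsUpperSet E)
    (hAE : ν.real (A ∩ E) = ν.real A * ν.real E) (hBE : ν.real (B ∩ E) = ν.real B * ν.real E) :
    ν.real (A ∩ B ∩ E) = ν.real (A ∩ B) * ν.real E := by
  -- The covariances of `A ∩ B` and `A ∪ B` with `E` are nonnegative and sum to zero.
  have h1 := hν.mul_le_inter (hA.inter hB) hE (hAu.inter hBu) hEu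
  have h2 := hν.mul_le_inter (hA.union hB) hE (hAu.union hBu) hEu
  have h3 := measureReal_union_add_inter (μ := ν) (s := A) hB
  have h4 := measureReal_union_add_inter (μ := ν) (s := A ∩ E) (hB.inter hE)
  rw [← Set.union_inter_distrib_right, ← Set.inter_inter_distrib_right, hAE, hBE, ← add_mul,
    ← h3, add_mul] at h4
  linarith

lemma biInter_indep [IsProbabilityMeasure ν] (hν : IsLatticeAssociated ν) {ι : Type*}
    (s : Finset ι) {A : ι → Set (V → ℝ)} {E : Set (V → ℝ)} (hA : ∀ i, MeasurableSet (A i))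
    (hAu : ∀ i, IsUpperSet (A i)) (hE : MeasurableSet E) (hEu : IsUpperSet E)
    (h : ∀ i ∈ s, ν.real (A i ∩ E) = ν.real (A i) * ν.real E) :
    ν.real ((⋂ i ∈ s, A i) ∩ E) = ν.real (⋂ i ∈ s, A i) * ν.real E := by
  classical
  induction s using Finset.induction_on with
  | empty => simp
  | insert i s hi ih =>
    rw [Finset.set_biInter_insert]
    exact hν.inter_indep (hA i) (s.measurableSet_biInter fun j _ => hA j) hE (hAu i)
      (isUpperSet_iInter₂ fun j _ => hAu j) hEu (h i (Finset.mem_insert_self i s))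
      (ih fun j hj => h j (Finset.mem_insert_of_mem hj))

/-- Pairwise independent upper sets are mutually independent. -/
lemma measureReal_biInter_eq_prod [IsProbabilityMeasure ν] (hν : IsLatticeAssociated ν)
    {ι : Type*} (s : Finset ι) {A : ι → Set (V → ℝ)} (hA : ∀ i, MeasurableSet (A i))
    (hAu : ∀ i, IsUpperSet (A i))
    (h : ∀ i j, i ≠ j → ν.real (A i ∩ A j) = ν.real (A i) * ν.real (A j)) :
    ν.real (⋂ i ∈ s, A i) = ∏ i ∈ s, ν.real (A i) := by
  classical
  induction s using Finset.induction_on with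
  | empty => simp
  | insert i s hi ih =>
    rw [Finset.set_biInter_insert, Finset.prod_insert hi, ← ih, Set.inter_comm, mul_comm]
    exact hν.biInter_indep s hA hAu (hA i) (hAu i) fun j hj => h j i fun e => hi (e ▸ hj)

/-- Two orthant events on families of coordinates are independent if the coordinates of the first
family are pairwise independent of those of the second. -/
lemma iInter_indep_iInter [IsProbabilityMeasure ν] (hν : IsLatticeAssociated ν) {ι κ : Type*}
    [Finite ι] [Finite κ] {A : ι → Set (V → ℝ)} {B : κ → Set (V → ℝ)}
    (hA : ∀ i, MeasurableSet (A i)) (hB : ∀ j, MeasurableSet (B j))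
    (hAu : ∀ i, IsUpperSet (A i)) (hBu : ∀ j, IsUpperSet (B j))
    (h : ∀ i j, ν.real (A i ∩ B j) = ν.real (A i) * ν.real (B j)) :
    ν.real ((⋂ i, A i) ∩ ⋂ j, B j) = ν.real (⋂ i, A i) * ν.real (⋂ j, B j) := by
  have := Fintype.ofFinite ι
  have := Fintype.ofFinite κ
  have h1 (j : κ) : ν.real ((⋂ i, A i) ∩ B j) = ν.real (⋂ i, A i) * ν.real (B j) := by
    simpa using hν.biInter_indep Finset.univ hA hAu (hB j) (hBu j) fun i _ => h i j
  have h2 := hν.biInter_indep (E := ⋂ i, A i) Finset.univ hB hBu (MeasurableSet.iInter hA)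
    (isUpperSet_iInter hAu) fun j _ => by rw [Set.inter_comm, h1 j, mul_comm]
  rw [Set.inter_comm, mul_comm]
  simpa using h2

end IsLatticeAssociated

/-! ### Independence tested on half-lines and orthants -/

lemma generateFrom_range_Ioi_real :
    (inferInstance : MeasurableSpace ℝ) = MeasurableSpace.generateFrom (Set.range Set.Ioi) := by
  rw [← borel_eq_generateFrom_Ioi ℝ]
  exact BorelSpace.measurable_eq

/-- Lets products of half-lines generate the product σ-algebra, although `ℝ` itself is no such
half-line. -/
lemma isCountablySpanning_range_Ioi_real : IsCountablySpanning (Set.range (Set.Ioi : ℝ → Set ℝ)) :=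
  ⟨fun n => Set.Ioi (-(n : ℝ)), fun n => ⟨_, rfl⟩, Set.eq_univ_of_forall fun x => by
    obtain ⟨n, hn⟩ := exists_nat_gt (-x)
    exact Set.mem_iUnion.2 ⟨n, by simp only [Set.mem_Ioi]; linarith⟩⟩

lemma indepFun_of_forall_Ioi {Ω : Type*} [MeasurableSpace Ω] {P : Measure Ω}
    [IsProbabilityMeasure P] {Y Z : Ω → ℝ} (hY : Measurable Y) (hZ : Measurable Z)
    (h : ∀ a b, P.real ({ω | a < Y ω} ∩ {ω | b < Z ω}) =
      P.real {ω | a < Y ω} * P.real {ω | b < Z ω}) : IndepFun Y Z P := by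
  have hgen (Y : Ω → ℝ) : MeasurableSpace.comap Y inferInstance =
      MeasurableSpace.generateFrom {s | ∃ t ∈ Set.range Set.Ioi, Y ⁻¹' t = s} := by
    rw [generateFrom_range_Ioi_real, MeasurableSpace.comap_generateFrom]
    rfl
  refine (IndepFun_iff_Indep _ _ _).2 (IndepSets.indep hY.comap_le hZ.comap_le
    (isPiSystem_Ioi.comap Y) (isPiSystem_Ioi.comap Z) (hgen Y) (hgen Z)
    ((IndepSets_iff _ _ _).2 ?_))
  rintro _ _ ⟨_, ⟨a, rfl⟩, rfl⟩ ⟨_, ⟨b, rfl⟩, rfl⟩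
  have := h a b
  rw [measureReal_def, measureReal_def, measureReal_def, ← ENNReal.toReal_mul] at this
  exact (ENNReal.toReal_eq_toReal_iff' (by finiteness) (by finiteness)).1 this

lemma iIndepFun_of_forall_orthant {Ω ι : Type*} [MeasurableSpace Ω] {P : Measure Ω}
    [IsProbabilityMeasure P] {κ : ι → Type*} [∀ i, Finite (κ i)] {Y : ∀ i, Ω → κ i → ℝ}
    (hY : ∀ i, Measurable (Y i))
    (h : ∀ (s : Finset ι) (a : ∀ i, κ i → ℝ), P.real (⋂ i ∈ s, {ω | ∀ k, a i k < Y i ω k}) =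
      ∏ i ∈ s, P.real {ω | ∀ k, a i k < Y i ω k}) : iIndepFun Y P := by
  classical
  have hgen (i : ι) : (MeasurableSpace.pi : MeasurableSpace (κ i → ℝ)) =
      MeasurableSpace.generateFrom
        (Set.pi Set.univ '' Set.pi Set.univ fun _ => Set.range Set.Ioi) := by
    rw [← generateFrom_pi_eq fun _ => isCountablySpanning_range_Ioi_real,
      ← generateFrom_range_Ioi_real]
  refine iIndepSets.iIndep (fun i => (hY i).comap_le)
    (fun i => {s | ∃ t ∈ Set.pi Set.univ '' Set.pi Set.univ fun _ => Set.range Set.Ioi,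
      Y i ⁻¹' t = s})
    (fun i => (IsPiSystem.pi fun _ => isPiSystem_Ioi).comap (Y i))
    (fun i => by beta_reduce; rw [hgen i, MeasurableSpace.comap_generateFrom]; rfl)
    ((iIndepSets_iff _ _).2 fun s f hf => ?_)
  have hf' (i : ι) : ∃ a : κ i → ℝ, i ∈ s → f i = {ω | ∀ k, a k < Y i ω k} := by
    by_cases hi : i ∈ s
    · obtain ⟨_, ⟨g, hg, rfl⟩, hfi⟩ := hf i hi
      choose a ha using fun k => hg k trivial
      refine ⟨a, fun _ => ?_⟩
      rw [← hfi]
      ext ω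
      simp [← ha]
    · exact ⟨0, fun h => absurd h hi⟩
  choose a ha using hf'
  have := h s a
  simp only [measureReal_def, ← ENNReal.toReal_prod] at this
  rw [ENNReal.toReal_eq_toReal_iff' (by finiteness)
    (ENNReal.prod_ne_top fun i _ => by finiteness)] at this
  rw [Finset.prod_congr rfl fun i hi => by rw [ha i hi], ← this]
  exact congrArg P (Set.iInter₂_congr ha)

/-- Self-independence makes every event of `Y` trivial; countably many Borel sets separate points,
so `Y` is almost surely constant. -/
lemma exists_map_eq_dirac_of_indepFun_self {Ω : Type*} [MeasurableSpace Ω] {P : Measure Ω}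
    [IsProbabilityMeasure P] {Y : Ω → ℝ} (hY : Measurable Y) (h : IndepFun Y Y P) :
    ∃ c, P.map Y = Measure.dirac c := by
  have h01 (U : Set ℝ) (hU : MeasurableSet U) : (∀ᵐ ω ∂P, Y ω ∈ U) ∨ ∀ᵐ ω ∂P, Y ω ∉ U := by
    rcases measure_eq_zero_or_one_of_indep_self (m := MeasurableSpace.comap Y inferInstance)
      (IndepFun_iff_Indep _ _ _ |>.1 h) ⟨U, hU, rfl⟩ with h0 | h1
    · exact Or.inr (measure_eq_zero_iff_ae_notMem.1 h0)
    · exact Or.inl ((prob_compl_eq_zero_iff (hY hU)).2 h1)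
  obtain ⟨c, hc⟩ := Filter.exists_eventuallyEq_const_of_forall_separating MeasurableSet h01
  refine ⟨c, ?_⟩
  rw [Measure.map_congr hc]
  change P.map (fun _ => c) = _
  rw [Measure.map_const, measure_univ, one_smul]

/-! ### Dependence classes -/

lemma exists_mul_lt_of_not_indepFun {V Ω : Type*} [MeasurableSpace Ω] {P : Measure Ω}
    [IsProbabilityMeasure P] {X : Ω → V → ℝ} (hX : Measurable X)
    (hν : IsLatticeAssociated (P.map X)) {u v : V}
    (h : ¬ IndepFun (fun ω => X ω u) (fun ω => X ω v) P) :
    ∃ a s, (P.map X).real {x | a < x u} * (P.map X).real {x | s < x v} <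
      (P.map X).real ({x | a < x u} ∩ {x | s < x v}) := by
  have := Measure.isProbabilityMeasure_map (μ := P) hX.aemeasurable
  have m (u : V) (a : ℝ) : MeasurableSet {x : V → ℝ | a < x u} :=
    measurable_pi_apply u measurableSet_Ioi
  have up (u : V) (a : ℝ) : IsUpperSet {x : V → ℝ | a < x u} :=
    fun x y hxy hx => lt_of_lt_of_le hx (hxy u)
  contrapose! h
  refine indepFun_of_forall_Ioi (by fun_prop) (by fun_prop) fun a b => ?_
  have := le_antisymm (h a b) (hν.mul_le_inter (m u a) (m v b) (up u a) (up v b))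
  rwa [map_measureReal_apply hX ((m u a).inter (m v b)), map_measureReal_apply hX (m u a),
    map_measureReal_apply hX (m v b)] at this

lemma measureReal_inter_eq_mul_of_indepFun {V Ω : Type*} [MeasurableSpace Ω] {P : Measure Ω}
    {X : Ω → V → ℝ} (hX : Measurable X) {u v : V}
    (h : IndepFun (fun ω => X ω u) (fun ω => X ω v) P) (a b : ℝ) :
    (P.map X).real ({x | a < x u} ∩ {x | b < x v}) =
      (P.map X).real {x | a < x u} * (P.map X).real {x | b < x v} := by
  have m (u : V) (a : ℝ) : MeasurableSet {x : V → ℝ | a < x u} :=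
    measurable_pi_apply u measurableSet_Ioi
  rw [map_measureReal_apply hX ((m u a).inter (m v b)), map_measureReal_apply hX (m u a),
    map_measureReal_apply hX (m v b)]
  simp only [measureReal_def, ← ENNReal.toReal_mul]
  exact congrArg _ (h.measure_inter_preimage_eq_mul _ _ measurableSet_Ioi measurableSet_Ioi)

/-- Marginal dependence is transitive. -/
lemma IsLatticeAssociated.not_indepFun_trans {V Ω : Type*} [MeasurableSpace Ω] {P : Measure Ω}
    [IsProbabilityMeasure P] {X : Ω → V → ℝ} (hX : Measurable X)
    (hν : IsLatticeAssociated (P.map X)) {u v w : V}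
    (huv : ¬ IndepFun (fun ω => X ω u) (fun ω => X ω v) P)
    (hvw : ¬ IndepFun (fun ω => X ω v) (fun ω => X ω w) P) :
    ¬ IndepFun (fun ω => X ω u) (fun ω => X ω w) P := by
  have := Measure.isProbabilityMeasure_map (μ := P) hX.aemeasurable
  have m (u : V) (a : ℝ) : MeasurableSet {x : V → ℝ | a < x u} :=
    measurable_pi_apply u measurableSet_Ioi
  have up (u : V) (a : ℝ) : IsUpperSet {x : V → ℝ | a < x u} :=
    fun x y hxy hx => lt_of_lt_of_le hx (hxy u)
  intro huw
  obtain ⟨a, s, has⟩ := exists_mul_lt_of_not_indepFun hX hν huv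
  obtain ⟨b, t, hbt⟩ := exists_mul_lt_of_not_indepFun hX hν fun h => hvw h.symm
  -- The event attached to the lower threshold of `v` must come first.
  rcases le_total s t with hst | hst
  · exact (hν.mul_lt_inter_of_mul_lt_inter (m u a) (m w b) (up u a) (up w b) v hst has hbt).ne'
      (measureReal_inter_eq_mul_of_indepFun hX huw a b)
  · exact (hν.mul_lt_inter_of_mul_lt_inter (m w b) (m u a) (up w b) (up u a) v hst hbt has).ne'
      (measureReal_inter_eq_mul_of_indepFun hX huw.symm b a)

/-- Disjoint blocks of coordinates that are pairwise independent across blocks are mutually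
independent. -/
lemma IsLatticeAssociated.iIndepFun_blocks {V Ω : Type*} [Finite V] [MeasurableSpace Ω]
    {P : Measure Ω} [IsProbabilityMeasure P] {X : Ω → V → ℝ} (hX : Measurable X)
    (hν : IsLatticeAssociated (P.map X)) (π : Set (Set V))
    (h : ∀ B ∈ π, ∀ C ∈ π, B ≠ C → ∀ u ∈ B, ∀ v ∈ C,
      IndepFun (fun ω => X ω u) (fun ω => X ω v) P) :
    iIndepFun (fun (B : π) (ω : Ω) (v : (B : Set V)) => X ω (v : V)) P := by
  have := Measure.isProbabilityMeasure_map (μ := P) hX.aemeasurable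
  have m (u : V) (a : ℝ) : MeasurableSet {x : V → ℝ | a < x u} :=
    measurable_pi_apply u measurableSet_Ioi
  have up (u : V) (a : ℝ) : IsUpperSet {x : V → ℝ | a < x u} :=
    fun x y hxy hx => lt_of_lt_of_le hx (hxy u)
  refine iIndepFun_of_forall_orthant (fun B => by fun_prop) fun s a => ?_
  set A : π → Set (V → ℝ) := fun B => ⋂ k : (B : Set V), {x | a B k < x k}
  have hA (B : π) : MeasurableSet (A B) := MeasurableSet.iInter fun k => m _ _
  have key := hν.measureReal_biInter_eq_prod s hA (fun B => isUpperSet_iInter fun k => up _ _)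
    fun B C hBC => hν.iInter_indep_iInter (fun k => m _ _) (fun k => m _ _) (fun k => up _ _)
      (fun k => up _ _) fun k l => measureReal_inter_eq_mul_of_indepFun hX
        (h B B.2 C C.2 (fun e => hBC (Subtype.ext e)) k k.2 l l.2) _ _
  have hpre (B : π) : X ⁻¹' A B = {ω | ∀ k : (B : Set V), a B k < X ω k} := by
    ext ω
    simp [A]
  rw [map_measureReal_apply hX (s.measurableSet_biInter fun B _ => hA B),
    Finset.prod_congr rfl fun B _ => map_measureReal_apply hX (hA B)] at key
  simpa only [Set.preimage_iInter, hpre] using key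

theorem mainTheorem2 {V Ω : Type*} [Fintype V] [MeasurableSpace Ω]
    (P : Measure Ω) [IsProbabilityMeasure P]
    (S : V → Set ℝ) (hS : ∀ v, IsStateSpace (S v))
    (X : Ω → V → ℝ) (hX : Measurable X)
    (hMTP2 : IsMTP2 S X P)
    (hnondeg : ∀ v, ∀ c : ℝ, P.map (fun ω => X ω v) ≠ Measure.dirac c) :
    ∃ π : Set (Set V), Setoid.IsPartition π ∧
      iIndepFun (fun (B : π) (ω : Ω) (v : (B : Set V)) => X ω (v : V)) P ∧
      ∀ B ∈ π, ∀ u ∈ B, ∀ v ∈ B, ¬ IndepFun (fun ω => X ω u) (fun ω => X ω v) P := by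
  have hν := hMTP2.isLatticeAssociated hS
  let r : Setoid V :=
    { r := fun u v => ¬ IndepFun (fun ω => X ω u) (fun ω => X ω v) P
      iseqv :=
        { refl := fun u h => by
            obtain ⟨c, hc⟩ := exists_map_eq_dirac_of_indepFun_self (by fun_prop) h
            exact hnondeg u c hc
          symm := fun h h' => h h'.symm
          trans := fun h h' => hν.not_indepFun_trans hX h h' } }
  refine ⟨r.classes, r.isPartition_classes, hν.iIndepFun_blocks hX _ ?_, ?_⟩
  · rintro _ ⟨p, rfl⟩ _ ⟨q, rfl⟩ hne u hu v hv
    by_contra hdep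
    refine hne (Set.ext fun x => ?_)
    have hpq : r p q := r.trans (r.symm hu) (r.trans hdep hv)
    exact ⟨fun hx => r.trans hx hpq, fun hx => r.trans hx (r.symm hpq)⟩
  · rintro _ ⟨p, rfl⟩ u hu v hv
    exact r.trans hu (r.symm hv)
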